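/- Let $K$ be a field, let $S = K[x_1,\dots,x_n]$ be the polynomial ring, and let $I \subseteq S$ be a nonzero monomial ideal whose projective dimension $p = \operatorname{projdim}(I)$ as an $S$-module satisfies $p \le 2$. Let $\beta(I) = (\beta_0(I), \dots, \beta_p(I))$ be the Betti sequence of $I$, where $\beta_i(I) = \dim_K \operatorname{Tor}_i^S(K, I)$ is the $i$-th total Betti number and $K = S/(x_1,\dots,x_n)$. Then there is a finite simplicial complex $\Delta$, acyclic over $K$ (that is, $\tilde H_i(\Delta; K) = 0$ for all $i \ge -1$), whose $f$-vector $f(\Delta) = (f_0, \dots, f_{\dim \Delta})$ equals $\beta(I)$, where $f_i$ is the number of $i$-dimensional faces of $\Delta$; in particular $\dim \Delta = p$. -/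

import Mathlib

open CategoryTheory

noncomputable section

/-- `I` is a monomial ideal: it is generated by a set of monomials. -/
def IsMonomialIdeal {K : Type*} [Field K] {n : ℕ} (I : Ideal (MvPolynomial (Fin n) K)) : Prop :=
  ∃ A : Set (Fin n →₀ ℕ),
    I = Ideal.span ((fun a => MvPolynomial.monomial a (1 : K)) '' A)

/-- The residue field of `S = K[x₁, …, xₙ]` at the irrelevant ideal, i.e. the `S`-module
`S / (x₁, …, xₙ)` (which is `K`). -/
abbrev residueModule (K : Type*) [Field K] (n : ℕ) : ModuleCat (MvPolynomial (Fin n) K) :=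
  ModuleCat.of (MvPolynomial (Fin n) K)
    (MvPolynomial (Fin n) K ⧸
      Ideal.span (Set.range (MvPolynomial.X : Fin n → MvPolynomial (Fin n) K)))

/-- The `i`-th total Betti number `βᵢ(I) = dim_K Torᵢ^S(K, I)` of an ideal `I` of
`S = K[x₁, …, xₙ]`. -/
def bettiNumber {K : Type*} [Field K] {n : ℕ} (I : Ideal (MvPolynomial (Fin n) K)) (i : ℕ) : ℕ :=
  Module.finrank K
    ((ModuleCat.restrictScalars (algebraMap K (MvPolynomial (Fin n) K))).obj
      (((Tor (ModuleCat (MvPolynomial (Fin n) K)) i).obj (residueModule K n)).obj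
        (ModuleCat.of (MvPolynomial (Fin n) K) I)))

/-- The projective dimension of `I` as an `S`-module. It is `⊥` exactly for `I = 0`. -/
def projDim {K : Type*} [Field K] {n : ℕ} (I : Ideal (MvPolynomial (Fin n) K)) : WithBot ℕ∞ :=
  projectiveDimension (ModuleCat.of (MvPolynomial (Fin n) K) I)

/-- The Betti sequence `(β₀(I), …, βₚ(I))`, where `p` is the projective dimension of the
nonzero ideal `I` (a natural number, by Hilbert's syzygy theorem). -/
def bettiSequence {K : Type*} [Field K] {n : ℕ} (I : Ideal (MvPolynomial (Fin n) K)) : List ℕ :=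
  (List.range (((projDim I).unbotD 0).toNat + 1)).map (bettiNumber I)

/-- The subquotient `Z / (Z ∩ B)` of a module (`Z / B` when `B ≤ Z`). -/
abbrev Subquotient {R M : Type*} [Ring R] [AddCommGroup M] [Module R M] (Z B : Submodule R M) :=
  Z ⧸ B.submoduleOf Z

theorem subsingleton_subquotient_iff {R M : Type*} [Ring R] [AddCommGroup M] [Module R M]
    (Z B : Submodule R M) : Subsingleton (Subquotient Z B) ↔ Z ≤ B := by
  simp only [Subquotient, Submodule.Quotient.subsingleton_iff, Submodule.submoduleOf_eq_top]

namespace AbstractSimplicialComplex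

variable {V : Type*}

/-- The set of faces with `j` vertices, i.e. of dimension `j - 1`. The empty set is the only
face with `0` vertices (Mathlib lists the nonempty faces only). -/
def facesOfCard (Δ : AbstractSimplicialComplex V) (j : ℕ) : Set (Finset V) :=
  {s | s.card = j ∧ (s = ∅ ∨ s ∈ Δ.faces)}

/-- The number `fᵢ(Δ)` of faces of dimension `i`. -/
def faceNumber (Δ : AbstractSimplicialComplex V) (i : ℕ) : ℕ :=
  (Δ.facesOfCard (i + 1)).ncard

/-- The largest number of vertices of a face of the finite complex `Δ`, that is, `d = dim Δ + 1`. -/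
def dimSucc (Δ : AbstractSimplicialComplex V) : ℕ :=
  sSup (Finset.card '' Δ.faces)

/-- The `f`-vector `(f₀, …, f_{d-1})` of the finite complex `Δ`, where `d - 1 = dim Δ`. -/
def fVector (Δ : AbstractSimplicialComplex V) : List ℕ :=
  (List.range Δ.dimSucc).map Δ.faceNumber

/-- The simplicial boundary operator, on chains of arbitrary finite subsets of `V`:
`∂[v₀ < ⋯ < vₖ] = ∑ᵢ (-1)ⁱ [v₀, …, v̂ᵢ, …, vₖ]`. In particular `∂[v] = [∅]` and `∂[∅] = 0`, so
this is the differential of the augmented chain complex. -/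
def boundary (K : Type*) [Field K] (V : Type*) [LinearOrder V] :
    (Finset V →₀ K) →ₗ[K] (Finset V →₀ K) :=
  Finsupp.lsum K fun s => LinearMap.toSpanSingleton K (Finset V →₀ K)
    (∑ v ∈ s, Finsupp.single (s.erase v) ((-1 : K) ^ (s.filter (· < v)).card))

variable (K : Type*) [Field K] [LinearOrder V]

/-- The module of reduced simplicial chains spanned by the faces with `j` vertices. -/
def chains (Δ : AbstractSimplicialComplex V) (j : ℕ) : Submodule K (Finset V →₀ K) :=
  Finsupp.supported K K (Δ.facesOfCard j)

/-- Reduced cycles of dimension `j - 1`. -/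
def cycles (Δ : AbstractSimplicialComplex V) (j : ℕ) : Submodule K (Finset V →₀ K) :=
  Δ.chains K j ⊓ LinearMap.ker (boundary K V)

/-- Reduced boundaries of dimension `j - 1`. -/
def boundaries (Δ : AbstractSimplicialComplex V) (j : ℕ) : Submodule K (Finset V →₀ K) :=
  (Δ.chains K (j + 1)).map (boundary K V)

theorem boundary_single (s : Finset V) :
    boundary K V (Finsupp.single s 1) =
      ∑ v ∈ s, Finsupp.single (s.erase v) ((-1 : K) ^ (s.filter (· < v)).card) := by
  simp [boundary]

/-- The boundary of a boundary vanishes. -/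
theorem boundary_boundary (c : Finset V →₀ K) : boundary K V (boundary K V c) = 0 := by
  suffices h : boundary K V ∘ₗ boundary K V = 0 from LinearMap.congr_fun h c
  ext1 s
  ext1
  simp only [LinearMap.comp_apply, Finsupp.lsingle_apply, LinearMap.zero_apply]
  rw [boundary_single, map_sum]
  have h1 : ∀ v, boundary K V (Finsupp.single (s.erase v) ((-1 : K) ^ (s.filter (· < v)).card))
      = ∑ w ∈ s.erase v, Finsupp.single ((s.erase v).erase w)
        ((-1 : K) ^ ((s.filter (· < v)).card + ((s.erase v).filter (· < w)).card)) := by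
    intro v
    rw [← mul_one ((-1 : K) ^ _), ← smul_eq_mul, ← Finsupp.smul_single, map_smul,
      boundary_single, Finset.smul_sum]
    simp [pow_add]
  simp only [h1]
  rw [Finset.sum_sigma']
  refine Finset.sum_involution (fun p _ => ⟨p.2, p.1⟩) ?_ ?_ ?_ ?_
  · rintro ⟨v, w⟩ h
    simp only [Finset.mem_sigma, Finset.mem_erase] at h
    obtain ⟨hv, hwv, hw⟩ := h
    dsimp only
    rw [Finset.erase_right_comm (a := w), ← Finsupp.single_add]
    have key : ∀ a b : V, a ∈ s → b ∈ s → a < b →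
        ((s.erase a).filter (· < b)).card + 1 = (s.filter (· < b)).card ∧
        ((s.erase b).filter (· < a)).card = (s.filter (· < a)).card := by
      intro a b ha hb hab
      constructor
      · rw [Finset.filter_erase, Finset.card_erase_add_one]
        simp [ha, hab]
      · rw [Finset.filter_erase, Finset.erase_eq_of_notMem]
        simp [hab.le]
    have : ((-1 : K) ^ ((s.filter (· < v)).card + ((s.erase v).filter (· < w)).card)
      + (-1 : K) ^ ((s.filter (· < w)).card + ((s.erase w).filter (· < v)).card)) = 0 := by
      rcases lt_or_gt_of_ne hwv with h | h
      · obtain ⟨e1, e2⟩ := key w v hw hv h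
        rw [← e1, e2]; ring
      · obtain ⟨e1, e2⟩ := key v w hv hw h
        rw [← e1, e2]; ring
    rw [this, Finsupp.single_zero]
  · rintro ⟨v, w⟩ h _ heq
    simp only [Finset.mem_sigma, Finset.mem_erase] at h
    simp only [Sigma.mk.injEq] at heq
    exact h.2.1 heq.1
  · rintro ⟨v, w⟩ h
    simp only [Finset.mem_sigma, Finset.mem_erase] at h ⊢
    tauto
  · rintro ⟨v, w⟩ h
    rfl

/-- Boundaries are cycles. -/
theorem boundaries_le_cycles (Δ : AbstractSimplicialComplex V) (j : ℕ) :
    Δ.boundaries K j ≤ Δ.cycles K j := by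
  rw [boundaries, Submodule.map_le_iff_le_comap, chains, Finsupp.supported_eq_span_single,
    Submodule.span_le]
  rintro _ ⟨s, ⟨hs, hs'⟩, rfl⟩
  have hne : s.Nonempty := Finset.card_pos.1 (by omega)
  have hs'' : s ∈ Δ.faces := hs'.resolve_left hne.ne_empty
  refine ⟨?_, boundary_boundary K _⟩
  rw [boundary_single]
  refine Submodule.sum_mem _ fun v hv => Finsupp.single_mem_supported K _ ⟨?_, ?_⟩
  · rw [Finset.card_erase_of_mem hv, hs]; rfl
  · rcases (s.erase v).eq_empty_or_nonempty with h | h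
    · exact Or.inl h
    · exact Or.inr ((Δ.isRelLowerSet_faces hs'').2 (Finset.erase_subset _ _) h)

/-- The reduced simplicial homology `H̃_{j-1}(Δ; K)`, cycles modulo boundaries. -/
abbrev ReducedHomology (Δ : AbstractSimplicialComplex V) (j : ℕ) :=
  Subquotient (Δ.cycles K j) (Δ.boundaries K j)

/-- `Δ` is acyclic over `K`: its reduced homology with coefficients in `K` vanishes in all
degrees (from `-1` on). -/
def IsAcyclic (Δ : AbstractSimplicialComplex V) : Prop :=
  ∀ j : ℕ, Subsingleton (Δ.ReducedHomology K j)

end AbstractSimplicialComplex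

end

/-! Let `r₀`, `r₁`, `r₂` be the Betti numbers of `I`. Since the projective dimension is at most two,
they are the ranks in a minimal resolution `0 → P₂ → P₁ → P₀ → I → 0`. Two facts suffice. Since a
nonzero ideal has rank one, `r₀ - r₁ + r₂ = 1`. Since the syzygies of `r₀` monomials are generated
by the pairwise ones (`ker_linearCombination_monomial`), `r₁ ≤ r₀.choose 2`.

Put `a = r₀ - 1`. Then `r₁ = a + r₂`, and Pascal's rule turns the inequality into `r₂ ≤ a.choose 2`:
exactly the condition for a graph with `a` vertices and `r₂` edges to exist. The cone over it is
acyclic and has `a + 1` vertices, `a + r₂` edges and `r₂` triangles.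

Minimality enters twice. It makes the differentials vanish after tensoring with the residue field,
so that the ranks are the Tor dimensions (`bettiNumber_eq_finrank`), and it makes the resolution
stop exactly at the projective dimension (`ker_eq_bot_of_projective`). It comes from irredundance of
homogeneous generators for the fine grading (`constantCoeff_eq_zero_of_irredundant`). -/

namespace AbstractSimplicialComplex

/-! ### Acyclicity of cones. -/

section Cone

variable {V : Type*} (K : Type*) [Field K] [LinearOrder V] [OrderBot V]

/-- The cone operator with apex `⊥` on simplicial chains. -/
noncomputable def coneMap : (Finset V →₀ K) →ₗ[K] (Finset V →₀ K) :=
  Finsupp.lsum K fun s => LinearMap.toSpanSingleton K (Finset V →₀ K)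
    (if ⊥ ∈ s then 0 else Finsupp.single (insert ⊥ s) 1)

theorem coneMap_single (s : Finset V) (a : K) :
    coneMap K (Finsupp.single s a) =
      if ⊥ ∈ s then 0 else Finsupp.single (insert ⊥ s) a := by
  by_cases h : ⊥ ∈ s <;> simp [coneMap, h]

/-- The apex is the smallest vertex, so it is removed with sign `+1`, and inserting it moves every
other vertex one place and flips its sign. The cross terms cancel, leaving a contracting homotopy.
-/
theorem boundary_coneMap (c : Finset V →₀ K) :
    boundary K V (coneMap K c) + coneMap K (boundary K V c) = c := by
  suffices h : boundary K V ∘ₗ coneMap K + coneMap K ∘ₗ boundary K V = LinearMap.id from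
    LinearMap.congr_fun h c
  ext1 s
  ext1
  simp only [LinearMap.comp_apply, Finsupp.lsingle_apply, LinearMap.add_apply, LinearMap.id_apply]
  rw [boundary_single, map_sum, coneMap_single]
  simp only [coneMap_single]
  by_cases h : ⊥ ∈ s
  · rw [if_pos h, map_zero, zero_add, Finset.sum_eq_single_of_mem ⊥ h]
    · simp [Finset.insert_erase h]
    · intro b _ hb
      simp [h, hb.symm]
  · rw [if_neg h, boundary_single, Finset.sum_insert h, add_assoc, ← Finset.sum_add_distrib,
      Finset.sum_eq_zero, add_zero]
    · simp [Finset.erase_insert h]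
    · intro v hv
      have hvb : v ≠ ⊥ := fun e => h (e ▸ hv)
      have h1 : ⊥ ∉ s.erase v := fun h' => h (Finset.mem_of_mem_erase h')
      rw [if_neg h1, Finset.erase_insert_of_ne hvb.symm, ← Finsupp.single_add,
        Finset.filter_insert, if_pos (bot_lt_iff_ne_bot.2 hvb), Finset.card_insert_of_notMem]
      · simp [pow_succ]
      · simp [h]

/-- By the homotopy a cycle is the boundary of its own cone. The case `s = ∅` of the hypothesis
makes the apex a vertex, which settles degree `-1`. -/
theorem isAcyclic_of_insert_bot_mem (Δ : AbstractSimplicialComplex V)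
    (h : ∀ s, s = ∅ ∨ s ∈ Δ.faces → insert ⊥ s ∈ Δ.faces) : Δ.IsAcyclic K := by
  intro j
  rw [subsingleton_subquotient_iff]
  rintro c ⟨hc, hc0⟩
  refine ⟨coneMap K c, ?_, ?_⟩
  · have : Δ.chains K j ≤ (Δ.chains K (j + 1)).comap (coneMap K) := by
      rw [chains, Finsupp.supported_eq_span_single, Submodule.span_le]
      rintro _ ⟨s, ⟨hs, hs'⟩, rfl⟩
      simp only [Submodule.comap_coe, Set.mem_preimage, coneMap_single]
      split_ifs with hb
      · exact Submodule.zero_mem _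
      · refine Finsupp.single_mem_supported K _ ⟨?_, Or.inr (h s hs')⟩
        rw [Finset.card_insert_of_notMem hb, hs]
    exact this hc
  · have := boundary_coneMap K c
    rwa [LinearMap.mem_ker.1 hc0, map_zero, add_zero] at this

end Cone

/-! ### Cones over graphs and their face numbers. -/

/-- The cone with apex `0` over the graph with vertices `1, …, a` and edge set `E`. -/
def graphCone (a : ℕ) (E : Finset (Finset (Fin (a + 1)))) (hE : ∀ e ∈ E, e.card = 2 ∧ 0 ∉ e) :
    AbstractSimplicialComplex (Fin (a + 1)) where
  faces := {s | s.Nonempty ∧ ((s.erase 0).card ≤ 1 ∨ s.erase 0 ∈ E)}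
  isRelLowerSet_faces := by
    rintro s ⟨hs, h⟩
    refine ⟨hs, fun t hts ht => ⟨ht, ?_⟩⟩
    have hsub : t.erase 0 ⊆ s.erase 0 := Finset.erase_subset_erase _ hts
    rcases h with h | h
    · exact Or.inl ((Finset.card_le_card hsub).trans h)
    · by_cases heq : t.erase 0 = s.erase 0
      · exact Or.inr (heq ▸ h)
      · have := Finset.card_lt_card (hsub.ssubset_of_ne heq)
        have := (hE _ h).1
        exact Or.inl (by omega)
  singleton_mem v := ⟨Finset.singleton_nonempty v,
    Or.inl ((Finset.card_le_card (Finset.erase_subset _ _)).trans (by simp))⟩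

section graphCone

variable {a : ℕ} {E : Finset (Finset (Fin (a + 1)))} (hE : ∀ e ∈ E, e.card = 2 ∧ 0 ∉ e)

theorem graphCone_isAcyclic (K : Type*) [Field K] : (graphCone a E hE).IsAcyclic K := by
  refine isAcyclic_of_insert_bot_mem K _ fun s hs => ⟨Finset.insert_nonempty _ _, ?_⟩
  rw [bot_eq_zero, Finset.erase_insert_eq_erase]
  rcases hs with rfl | hs
  · simp
  · exact hs.2

theorem graphCone_faceNumber_zero : (graphCone a E hE).faceNumber 0 = a + 1 := by
  have : (graphCone a E hE).facesOfCard 1 = Set.range (fun v : Fin (a + 1) => ({v} : Finset _)) := by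
    ext s
    simp only [facesOfCard, Set.mem_ofPred_eq, Finset.card_eq_one, Set.mem_range]
    constructor
    · rintro ⟨⟨v, rfl⟩, -⟩
      exact ⟨v, rfl⟩
    · rintro ⟨v, rfl⟩
      exact ⟨⟨v, rfl⟩, Or.inr ((graphCone a E hE).singleton_mem v)⟩
  rw [faceNumber, zero_add, this, ← Set.image_univ, Set.ncard_image_of_injective _
    Finset.singleton_injective, Set.ncard_univ, Nat.card_fin]

theorem graphCone_faceNumber_one : (graphCone a E hE).faceNumber 1 = a + E.card := by
  have : (graphCone a E hE).facesOfCard 2 =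
      ((Finset.univ.erase 0).image (fun v : Fin (a + 1) => ({0, v} : Finset _)) ∪ E :
        Finset (Finset (Fin (a + 1)))) := by
    ext s
    simp only [facesOfCard, graphCone, Set.mem_ofPred_eq, Finset.coe_union, Finset.coe_image,
      Set.mem_union, Set.mem_image, Finset.mem_coe, Finset.mem_erase, Finset.mem_univ, and_true]
    constructor
    · rintro ⟨hs, rfl | ⟨hs0, h⟩⟩
      · simp at hs
      · by_cases h0 : 0 ∈ s
        · left
          have := Finset.card_erase_add_one h0
          obtain ⟨v, hv⟩ := Finset.card_eq_one.1 (show (s.erase 0).card = 1 by omega)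
          refine ⟨v, ?_, ?_⟩
          · exact Finset.ne_of_mem_erase (hv ▸ Finset.mem_singleton_self v)
          · rw [← Finset.insert_erase h0, hv]
        · rw [Finset.erase_eq_of_notMem h0] at h
          exact Or.inr (h.resolve_left (by omega))
    · rintro (⟨v, hv, rfl⟩ | hs)
      · refine ⟨Finset.card_pair (Ne.symm hv), Or.inr ⟨by simp, Or.inl ?_⟩⟩
        rw [Finset.erase_insert (by simpa using hv.symm)]
        simp
      · obtain ⟨h1, h2⟩ := hE s hs
        refine ⟨h1, Or.inr ⟨Finset.card_pos.1 (by omega), Or.inr ?_⟩⟩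
        rwa [Finset.erase_eq_of_notMem h2]
  rw [faceNumber, this, Set.ncard_coe_finset, Finset.card_union_of_disjoint,
    Finset.card_image_of_injOn]
  · simp
  · intro v hv w hw h
    simp only [Finset.coe_erase, Finset.coe_univ, Set.mem_sdiff, Set.mem_univ,
      Set.mem_singleton_iff, true_and] at hv hw
    have : v ∈ ({0, w} : Finset (Fin (a + 1))) := by
      rw [← show ({0, v} : Finset (Fin (a + 1))) = {0, w} from h]; simp
    simpa [hv] using this
  · rw [Finset.disjoint_left]
    intro s hs hsE
    obtain ⟨v, -, rfl⟩ := Finset.mem_image.1 hs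
    exact (hE _ hsE).2 (by simp)

theorem graphCone_faceNumber_two : (graphCone a E hE).faceNumber 2 = E.card := by
  have : (graphCone a E hE).facesOfCard 3 =
      (E.image (insert 0) : Finset (Finset (Fin (a + 1)))) := by
    ext s
    simp only [facesOfCard, graphCone, Set.mem_ofPred_eq, Finset.coe_image, Set.mem_image,
      Finset.mem_coe]
    constructor
    · rintro ⟨hs, rfl | ⟨hs0, h⟩⟩
      · simp at hs
      · have h1 := Finset.pred_card_le_card_erase (s := s) (a := 0)
        have h2 := h.resolve_left (by omega)
        refine ⟨_, h2, Finset.insert_erase ?_⟩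
        by_contra h0
        rw [Finset.erase_eq_of_notMem h0] at h2
        have := (hE _ h2).1
        omega
    · rintro ⟨e, he, rfl⟩
      obtain ⟨h1, h2⟩ := hE e he
      refine ⟨by rw [Finset.card_insert_of_notMem h2, h1], Or.inr ⟨Finset.insert_nonempty _ _,
        Or.inr ?_⟩⟩
      rwa [Finset.erase_insert h2]
  rw [faceNumber, this, Set.ncard_coe_finset, Finset.card_image_of_injOn]
  intro e he e' he' h
  rw [← Finset.erase_insert (hE e he).2, ← Finset.erase_insert (hE e' he').2]
  exact congrArg (Finset.erase · 0) h

theorem graphCone_dimSucc {p : ℕ} (ha : a = 0 ↔ p = 0) (hb : E.card = 0 ↔ p ≤ 1) (hp : p ≤ 2) :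
    (graphCone a E hE).dimSucc = p + 1 := by
  refine IsGreatest.csSup_eq ⟨?_, ?_⟩
  -- The bound is attained because `f_p` is positive: it is `a + 1`, `a + E.card` or `E.card`.
  · have key : 0 < (graphCone a E hE).faceNumber p := by
      interval_cases p
      · rw [graphCone_faceNumber_zero]; omega
      · rw [graphCone_faceNumber_one]; omega
      · rw [graphCone_faceNumber_two]; omega
    obtain ⟨s, hs, hs'⟩ := Set.nonempty_of_ncard_ne_zero key.ne'
    refine ⟨s, hs'.resolve_left ?_, hs⟩
    rintro rfl
    simp at hs
  · rintro _ ⟨s, ⟨-, hs⟩, rfl⟩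
    have h1 := Finset.pred_card_le_card_erase (s := s) (a := 0)
    rcases hs with hs | hs
    · rcases Nat.eq_zero_or_pos p with rfl | h
      · have : a = 0 := ha.2 rfl
        subst this
        simpa using Finset.card_le_univ s
      · omega
    · have h2 := (hE _ hs).1
      have h3 := Finset.card_pos.2 ⟨_, hs⟩
      omega

end graphCone

/-- Numerical description of the `f`-vectors of cones over graphs. -/
theorem exists_isAcyclic_fVector_eq (K : Type*) [Field K] {p r₀ r₁ r₂ : ℕ} (β : ℕ → ℕ)
    (h₀ : β 0 = r₀) (h₁ : β 1 = r₁) (h₂ : β 2 = r₂) (hp : p ≤ 2)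
    (euler : r₀ + r₂ = r₁ + 1) (hle : r₁ ≤ r₀.choose 2)
    (hr₁ : r₁ = 0 ↔ p = 0) (hr₂ : r₂ = 0 ↔ p ≤ 1) :
    ∃ (m : ℕ) (Δ : AbstractSimplicialComplex (Fin m)),
      Δ.IsAcyclic K ∧ Δ.fVector = (List.range (p + 1)).map β := by
  -- If `r₀ = 0`, then `r₁ = 0` forces `p = 0`, while the Euler relation gives `r₂ = 1` and hence `p
  -- > 1`.
  obtain ⟨a, rfl⟩ : ∃ a, r₀ = a + 1 := by
    refine Nat.exists_eq_succ_of_ne_zero ?_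
    rintro rfl
    simp at hle
    omega
  have hch : r₂ ≤ a.choose 2 := by
    have : (a + 1).choose 2 = a + a.choose 2 := by
      rw [Nat.choose_succ_succ' a 1, Nat.choose_one_right]
    omega
  have ha : a = 0 ↔ p = 0 := by
    rw [← hr₁]
    refine ⟨?_, by omega⟩
    rintro rfl
    simp at hch
    omega
  -- Any `r₂` of the `a.choose 2` pairs avoiding the apex serve as edges.
  obtain ⟨E, hEs, hEc⟩ := Finset.exists_subset_card_eq
    (s := Finset.powersetCard 2 ((Finset.univ : Finset (Fin (a + 1))).erase 0)) (n := r₂)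
    (by simpa [Finset.card_powersetCard] using hch)
  have hE : ∀ e ∈ E, e.card = 2 ∧ 0 ∉ e := by
    intro e he
    obtain ⟨h, h'⟩ := Finset.mem_powersetCard.1 (hEs he)
    exact ⟨h', fun h0 => by simpa using h h0⟩
  refine ⟨a + 1, graphCone a E hE, graphCone_isAcyclic hE K, ?_⟩
  rw [fVector, graphCone_dimSucc hE (p := p) ha (by omega) hp]
  refine List.map_congr_left fun i hi => ?_
  have hi : i ≤ 2 := by have := List.mem_range.1 hi; omega
  interval_cases i
  · rw [graphCone_faceNumber_zero, h₀]
  · rw [graphCone_faceNumber_one, h₁]; omega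
  · rw [graphCone_faceNumber_two, h₂, hEc]

end AbstractSimplicialComplex

/-! ### Resolutions of length two and derived functors. -/

section Resolution

open Limits ZeroObject

variable {C : Type*} [Category* C] [Abelian C] {P₀ P₁ P₂ M : C}

/-- The objects of the complex `⋯ ⟶ 0 ⟶ P₂ ⟶ P₁ ⟶ P₀`. -/
noncomputable def threeTermX (P₀ P₁ P₂ : C) : ℕ → C
  | 0 => P₀
  | 1 => P₁
  | 2 => P₂
  | _ + 3 => 0

/-- The differentials of the complex `⋯ ⟶ 0 ⟶ P₂ ⟶ P₁ ⟶ P₀`. -/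
noncomputable def threeTermD (f : P₁ ⟶ P₀) (g : P₂ ⟶ P₁) :
    (n : ℕ) → (threeTermX P₀ P₁ P₂ (n + 1) ⟶ threeTermX P₀ P₁ P₂ n)
  | 0 => f
  | 1 => g
  | _ + 2 => 0

/-- The complex `⋯ ⟶ 0 ⟶ P₂ ⟶ P₁ ⟶ P₀`. -/
noncomputable def threeTermComplex (f : P₁ ⟶ P₀) (g : P₂ ⟶ P₁) (w : g ≫ f = 0) :
    ChainComplex C ℕ :=
  ChainComplex.of (threeTermX P₀ P₁ P₂) (threeTermD f g) fun
    | 0 => w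
    | _ + 1 => zero_comp

theorem threeTermComplex_d (f : P₁ ⟶ P₀) (g : P₂ ⟶ P₁) (w : g ≫ f = 0) (n : ℕ) :
    (threeTermComplex f g w).d (n + 1) n = threeTermD f g n :=
  ChainComplex.of_d _ _ _

theorem threeTermComplex_exactAt_succ (f : P₁ ⟶ P₀) (g : P₂ ⟶ P₁) (w : g ≫ f = 0)
    (hgf : (ShortComplex.mk g f w).Exact) [Mono g] (n : ℕ) :
    (threeTermComplex f g w).ExactAt (n + 1) := by
  rw [HomologicalComplex.exactAt_iff' _ (n + 1 + 1) (n + 1) n (by simp) (by simp)]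
  match n with
  | 0 =>
    refine (ShortComplex.exact_iff_of_iso ?_).2 hgf
    exact ShortComplex.isoMk (Iso.refl P₂) (Iso.refl P₁) (Iso.refl P₀)
      (by
        have := threeTermComplex_d f g w 1
        exact (Category.id_comp _).trans (this.symm.trans (Category.comp_id _).symm))
      (by
        have := threeTermComplex_d f g w 0
        exact (Category.id_comp _).trans (this.symm.trans (Category.comp_id _).symm))
  | 1 =>
    have h : (ShortComplex.mk (0 : (0 : C) ⟶ P₂) g zero_comp).Exact :=
      (ShortComplex.exact_iff_mono _ rfl).2 ‹_›
    refine (ShortComplex.exact_iff_of_iso ?_).2 h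
    exact ShortComplex.isoMk (Iso.refl (0 : C)) (Iso.refl P₂) (Iso.refl P₁)
      ((isZero_zero C).eq_of_src _ _)
      (by
        have := threeTermComplex_d f g w 1
        exact (Category.id_comp _).trans (this.symm.trans (Category.comp_id _).symm))
  | n + 2 => exact ShortComplex.exact_of_isZero_X₂ _ (isZero_zero C)

/-- A projective resolution of length two. -/
noncomputable def threeTermResolution (f : P₁ ⟶ P₀) (g : P₂ ⟶ P₁) (p : P₀ ⟶ M) (w : g ≫ f = 0)
    (w' : f ≫ p = 0) (hgf : (ShortComplex.mk g f w).Exact) (hfp : (ShortComplex.mk f p w').Exact)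
    [Mono g] [Epi p] [Projective P₀] [Projective P₁] [Projective P₂] : ProjectiveResolution M where
  complex := threeTermComplex f g w
  projective := fun
    | 0 => ‹Projective P₀›
    | 1 => ‹Projective P₁›
    | 2 => ‹Projective P₂›
    | _ + 3 => (isZero_zero C).projective
  π := (ChainComplex.toSingle₀Equiv _ _).symm ⟨p, by rw [threeTermComplex_d]; exact w'⟩
  quasiIso := ⟨fun n => by
    cases n
    · rw [ChainComplex.quasiIsoAt₀_iff, ShortComplex.quasiIso_iff_of_zeros']
      · refine (ShortComplex.exact_and_epi_g_iff_of_iso ?_).2 ⟨hfp, by dsimp; infer_instance⟩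
        exact ShortComplex.isoMk (Iso.refl P₁) (Iso.refl P₀) (Iso.refl M)
          (by
            have := threeTermComplex_d f g w 0
            exact (Category.id_comp _).trans (this.symm.trans (Category.comp_id _).symm))
          (by
            refine (Category.id_comp _).trans (Eq.trans ?_ (Category.comp_id _).symm)
            exact (ChainComplex.toSingle₀Equiv_symm_apply_f_zero (C := threeTermComplex f g w) p
              (by rw [threeTermComplex_d]; exact w')).symm)
      all_goals rfl
    · rw [quasiIsoAt_iff_exactAt']
      · exact threeTermComplex_exactAt_succ f g w hgf _
      · apply ChainComplex.exactAt_succ_single_obj⟩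

/-- A chain complex with zero differentials is its own homology. -/
noncomputable def homologyIsoOfDEqZero (K : ChainComplex C ℕ) (h : ∀ n, K.d (n + 1) n = 0) (i : ℕ) :
    K.homology i ≅ K.X i :=
  (K.isoHomologyπ (i + 1) i (by simp) (h i)).symm ≪≫
    K.iCyclesIso i ((ComplexShape.down ℕ).next i) rfl (by
      cases i with
      | zero => exact K.shape _ _ (by simp)
      | succ i => rw [ChainComplex.next_nat_succ]; exact h i)

/-- If `F` kills the differentials of a projective resolution, its left derived functors are
computed by the terms of the resolution. -/
noncomputable def leftDerivedObjIso {D : Type*} [Category* D] [Abelian D]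
    [HasProjectiveResolutions C] (F : C ⥤ D) [F.Additive] (P : ProjectiveResolution M)
    (h : ∀ n, F.map (P.complex.d (n + 1) n) = 0) (i : ℕ) :
    (F.leftDerived i).obj M ≅ F.obj (P.complex.X i) :=
  P.isoLeftDerivedObj F i ≪≫ homologyIsoOfDEqZero ((F.mapHomologicalComplex _).obj P.complex) h i

end Resolution

/-! ### Minimality and ranks of projective modules. -/

section Minimal

variable {R : Type*} [CommRing R] (𝔪 : Ideal R)

theorem lTensor_eq_zero_of_forall_mem_smul_top {P Q : Type*} [AddCommGroup P] [Module R P]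
    [AddCommGroup Q] [Module R Q] (f : P →ₗ[R] Q) (hf : ∀ x, f x ∈ 𝔪 • (⊤ : Submodule R Q)) :
    LinearMap.lTensor (R ⧸ 𝔪) f = 0 := by
  refine TensorProduct.ext' fun a x => ?_
  rw [LinearMap.lTensor_tmul, LinearMap.zero_apply]
  refine Submodule.smul_induction_on (p := fun y => a ⊗ₜ[R] y = 0) (hf x) ?_ ?_
  · intro r hr y _
    rw [TensorProduct.tmul_smul, TensorProduct.smul_tmul']
    have : r • a = 0 := by
      rw [Algebra.smul_def, Ideal.Quotient.algebraMap_eq, Ideal.Quotient.eq_zero_iff_mem.2 hr,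
        zero_mul]
    rw [this, TensorProduct.zero_tmul]
  · intro y z hy hz
    rw [TensorProduct.tmul_add, hy, hz, add_zero]

/-- A submodule of a finite torsion-free module over a Noetherian domain that lies in `𝔪 F` and
has a projective quotient vanishes. -/
theorem ker_eq_bot_of_projective [IsDomain R] [IsNoetherianRing R] (h𝔪 : 𝔪 ≠ ⊤)
    {F M : Type*} [AddCommGroup F] [Module R F] [Module.Finite R F] [Module.IsTorsionFree R F]
    [AddCommGroup M] [Module R M] [Module.Projective R M] (p : F →ₗ[R] M)
    (hp : Function.Surjective p) (h : LinearMap.ker p ≤ 𝔪 • ⊤) : LinearMap.ker p = ⊥ := by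
  obtain ⟨s, hs⟩ := Module.projective_lifting_property p LinearMap.id hp
  have hs' : ∀ y, p (s y) = y := fun y => LinearMap.congr_fun hs y
  -- The map `id - s ∘ p` retracts `F` onto `ker p`; applied to `ker p ≤ 𝔪 • ⊤` it gives the
  -- hypothesis of Nakayama's lemma.
  have hN : LinearMap.ker p ≤ 𝔪 • LinearMap.ker p := by
    intro x hx
    have h1 : ((LinearMap.id : F →ₗ[R] F) - s ∘ₗ p) x ∈ (𝔪 • ⊤ : Submodule R F).map (LinearMap.id - s ∘ₗ p) :=
      Submodule.mem_map_of_mem (h hx)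
    rw [Submodule.map_smul''] at h1
    have h2 : (⊤ : Submodule R F).map (LinearMap.id - s ∘ₗ p) ≤ LinearMap.ker p := by
      rintro _ ⟨y, -, rfl⟩
      simp [hs']
    have h3 : ((LinearMap.id : F →ₗ[R] F) - s ∘ₗ p) x = x := by
      simp [LinearMap.mem_ker.1 hx]
    rw [h3] at h1
    exact Submodule.smul_mono le_rfl h2 h1
  -- No local ring is needed: some `r ≡ 1` mod `𝔪` kills the kernel, `r` is nonzero as `𝔪` is
  -- proper, and `F` is torsion-free.
  obtain ⟨r, hr, hr0⟩ := Submodule.exists_sub_one_mem_and_smul_eq_zero_of_fg_of_le_smul 𝔪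
    (LinearMap.ker p) (IsNoetherian.noetherian _) hN
  rw [eq_bot_iff]
  intro x hx
  have hr' : r ≠ 0 := by
    rintro rfl
    refine h𝔪 ((Ideal.eq_top_iff_one _).2 ?_)
    simpa using 𝔪.neg_mem hr
  exact (smul_eq_zero.1 (hr0 x hx)).resolve_left hr'

/-- A finite projective module over a domain has constant rank, so its fibre at `𝔪` has the generic
dimension. Hence the last term of the resolution need only be projective, not free. -/
theorem finrank_quotient_tensor [IsDomain R] (h𝔪 : 𝔪.IsMaximal) (M : Type*) [AddCommGroup M]
    [Module R M] [Module.Finite R M] [Module.Projective R M] :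
    Module.finrank (R ⧸ 𝔪) (TensorProduct R (R ⧸ 𝔪) M) = Module.finrank R M := by
  let := Ideal.Quotient.field 𝔪
  have h1 := Module.rankAtStalk_baseChange (R := R) (M := M) (S := R ⧸ 𝔪) ⊥
  rw [Module.rankAtStalk_eq_finrank_of_free] at h1
  have h2 := Ideal.finrank_fiber_eq_finrank (R := R) (M := M)
    (PrimeSpectrum.comap (algebraMap R (R ⧸ 𝔪)) ⊥).asIdeal
  rw [Ideal.finrank_fiber_eq_rankAtStalk] at h2
  exact h1.trans h2

end Minimal

/-! ### Betti numbers from a minimal resolution. -/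

section Betti

universe u

variable {K : Type u} [Field K] {n : ℕ}

theorem MvPolynomial.mem_idealOfVars_iff {σ R : Type*} [CommSemiring R] (f : MvPolynomial σ R) :
    f ∈ MvPolynomial.idealOfVars σ R ↔ MvPolynomial.constantCoeff f = 0 := by
  rw [← pow_one (MvPolynomial.idealOfVars σ R), MvPolynomial.mem_pow_idealOfVars_iff',
    MvPolynomial.constantCoeff_eq]
  refine ⟨fun h => h 0 (by simp), fun h x hx => ?_⟩
  rw [Nat.lt_one_iff, Finsupp.degree_eq_zero_iff] at hx
  rw [hx, h]

theorem MvPolynomial.idealOfVars_eq_ker {σ R : Type*} [CommRing R] :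
    MvPolynomial.idealOfVars σ R = RingHom.ker (MvPolynomial.constantCoeff (σ := σ) (R := R)) :=
  Ideal.ext fun f => MvPolynomial.mem_idealOfVars_iff f

theorem MvPolynomial.isMaximal_idealOfVars (σ : Type*) :
    (MvPolynomial.idealOfVars σ K).IsMaximal := by
  rw [MvPolynomial.idealOfVars_eq_ker]
  exact RingHom.ker_isMaximal_of_surjective _ fun a => ⟨MvPolynomial.C a, by simp⟩

/-- The map `K → S ⧸ 𝔪` is bijective, so the dimension over `K` is that of the fibre at `𝔪`. -/
theorem finrank_restrictScalars_residue_tensor (M : Type u) [AddCommGroup M]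
    [Module (MvPolynomial (Fin n) K) M] [Module.Finite (MvPolynomial (Fin n) K) M]
    [Module.Projective (MvPolynomial (Fin n) K) M] :
    Module.finrank K ((ModuleCat.restrictScalars (algebraMap K (MvPolynomial (Fin n) K))).obj
      (ModuleCat.of (MvPolynomial (Fin n) K) (TensorProduct (MvPolynomial (Fin n) K)
        (MvPolynomial (Fin n) K ⧸ MvPolynomial.idealOfVars (Fin n) K) M))) =
      Module.finrank (MvPolynomial (Fin n) K) M := by
  set S := MvPolynomial (Fin n) K
  set 𝔪 : Ideal S := MvPolynomial.idealOfVars (Fin n) K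
  have h𝔪 : 𝔪.IsMaximal := MvPolynomial.isMaximal_idealOfVars (Fin n)
  let := Ideal.Quotient.field 𝔪
  rw [← finrank_quotient_tensor 𝔪 h𝔪 M]
  have hbij : Function.Bijective (algebraMap K (S ⧸ 𝔪)) := by
    refine ⟨(algebraMap K (S ⧸ 𝔪)).injective, fun y => ?_⟩
    obtain ⟨f, rfl⟩ := Ideal.Quotient.mk_surjective y
    refine ⟨MvPolynomial.constantCoeff f, ?_⟩
    refine Ideal.Quotient.eq.2 ((MvPolynomial.mem_idealOfVars_iff _).2 ?_)
    simp [S, MvPolynomial.algebraMap_eq]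
  refine congrArg Cardinal.toNat (rank_eq_of_equiv_equiv
    (M := (ModuleCat.restrictScalars (algebraMap K S)).obj
      (ModuleCat.of S (TensorProduct S (S ⧸ 𝔪) M)))
    (M₁ := TensorProduct S (S ⧸ 𝔪) M) (algebraMap K (S ⧸ 𝔪))
    (AddEquiv.refl (TensorProduct S (S ⧸ 𝔪) M)) hbij fun a (x : TensorProduct S (S ⧸ 𝔪) M) => ?_)
  change (algebraMap K S a) • x = _
  exact (algebraMap_smul (S ⧸ 𝔪) (algebraMap K S a) x).symm

/-- Betti numbers are read off from a minimal resolution of length two. -/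
theorem bettiNumber_eq_finrank (I : Ideal (MvPolynomial (Fin n) K)) {P₀ P₁ P₂ : Type u}
    [AddCommGroup P₀] [Module (MvPolynomial (Fin n) K) P₀]
    [Module.Finite (MvPolynomial (Fin n) K) P₀] [Module.Projective (MvPolynomial (Fin n) K) P₀]
    [AddCommGroup P₁] [Module (MvPolynomial (Fin n) K) P₁]
    [Module.Finite (MvPolynomial (Fin n) K) P₁] [Module.Projective (MvPolynomial (Fin n) K) P₁]
    [AddCommGroup P₂] [Module (MvPolynomial (Fin n) K) P₂]
    [Module.Finite (MvPolynomial (Fin n) K) P₂] [Module.Projective (MvPolynomial (Fin n) K) P₂]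
    (p : P₀ →ₗ[MvPolynomial (Fin n) K] I) (f : P₁ →ₗ[MvPolynomial (Fin n) K] P₀)
    (g : P₂ →ₗ[MvPolynomial (Fin n) K] P₁) (hp : Function.Surjective p)
    (hfp : Function.Exact f p) (hgf : Function.Exact g f) (hg : Function.Injective g)
    (hf𝔪 : ∀ x, f x ∈ MvPolynomial.idealOfVars (Fin n) K •
      (⊤ : Submodule (MvPolynomial (Fin n) K) P₀))
    (hg𝔪 : ∀ x, g x ∈ MvPolynomial.idealOfVars (Fin n) K •
      (⊤ : Submodule (MvPolynomial (Fin n) K) P₁)) :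
    bettiNumber I 0 = Module.finrank (MvPolynomial (Fin n) K) P₀ ∧
    bettiNumber I 1 = Module.finrank (MvPolynomial (Fin n) K) P₁ ∧
    bettiNumber I 2 = Module.finrank (MvPolynomial (Fin n) K) P₂ := by
  have w : ModuleCat.ofHom g ≫ ModuleCat.ofHom f = 0 := by
    ext x
    exact hgf.apply_apply_eq_zero x
  have w' : ModuleCat.ofHom f ≫ ModuleCat.ofHom p = 0 := by
    refine ModuleCat.hom_ext (LinearMap.ext fun x => ?_)
    exact hfp.apply_apply_eq_zero x
  have e1 : (ShortComplex.mk _ _ w).Exact :=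
    (ShortComplex.moduleCat_exact_iff _).2 fun x hx => (hgf x).1 hx
  have e2 : (ShortComplex.mk _ _ w').Exact :=
    (ShortComplex.moduleCat_exact_iff _).2 fun x hx => (hfp x).1 hx
  have : Mono (ModuleCat.ofHom g) := (ModuleCat.mono_iff_injective _).2 hg
  have : Epi (ModuleCat.ofHom p) := (ModuleCat.epi_iff_surjective _).2 hp
  have : Projective (ModuleCat.of (MvPolynomial (Fin n) K) P₀) := (IsProjective.iff_projective P₀).1 inferInstance
  have : Projective (ModuleCat.of (MvPolynomial (Fin n) K) P₁) := (IsProjective.iff_projective P₁).1 inferInstance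
  have : Projective (ModuleCat.of (MvPolynomial (Fin n) K) P₂) := (IsProjective.iff_projective P₂).1 inferInstance
  let P := threeTermResolution _ _ _ w w' e1 e2
  have hP : ∀ i, ((MonoidalCategory.tensoringLeft (ModuleCat (MvPolynomial (Fin n) K))).obj (residueModule K n)).map
      (P.complex.d (i + 1) i) = 0 := by
    intro i
    have hd : P.complex.d (i + 1) i = threeTermD (ModuleCat.ofHom f) (ModuleCat.ofHom g) i :=
      threeTermComplex_d _ _ w i
    rw [hd]
    match i with
    | 0 =>
      refine ModuleCat.hom_ext ?_
      exact lTensor_eq_zero_of_forall_mem_smul_top (MvPolynomial.idealOfVars (Fin n) K) f hf𝔪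
    | 1 =>
      refine ModuleCat.hom_ext ?_
      exact lTensor_eq_zero_of_forall_mem_smul_top (MvPolynomial.idealOfVars (Fin n) K) g hg𝔪
    | i + 2 => exact Functor.map_zero _ _ _
  have key := fun i => LinearEquiv.finrank_eq ((ModuleCat.restrictScalars (algebraMap K (MvPolynomial (Fin n) K))).mapIso
    (leftDerivedObjIso ((MonoidalCategory.tensoringLeft (ModuleCat (MvPolynomial (Fin n) K))).obj (residueModule K n))
      P hP i)).toLinearEquiv
  refine ⟨(key 0).trans ?_, (key 1).trans ?_, (key 2).trans ?_⟩
  · have h := finrank_restrictScalars_residue_tensor (K := K) (n := n) P₀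
    exact h
  · have h := finrank_restrictScalars_residue_tensor (K := K) (n := n) P₁
    exact h
  · have h := finrank_restrictScalars_residue_tensor (K := K) (n := n) P₂
    exact h

end Betti

/-! ### Irredundant generating families. -/

section Irredundant

variable {R M : Type*} [CommRing R] [AddCommGroup M] [Module R M]

/-- A submodule spanned by `T` has an irredundant finite generating family taken from `T`. -/
theorem exists_irredundant_family [IsNoetherian R M] (T : Set M) :
    ∃ (r : ℕ) (w : Fin r → M), (∀ j, w j ∈ T) ∧
      Submodule.span R (Set.range w) = Submodule.span R T ∧
      (∀ j, w j ∉ Submodule.span R (w '' {j}ᶜ)) ∧ (T.Finite → r ≤ T.ncard) := by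
  classical
  have hex : ∃ (r : ℕ) (t : Finset M), (t : Set M) ⊆ T ∧
      Submodule.span R (t : Set M) = Submodule.span R T ∧ t.card = r := by
    obtain ⟨t, ht, h⟩ := (Submodule.fg_span_iff_fg_span_finset_subset T).1
      (IsNoetherian.noetherian (Submodule.span R T))
    exact ⟨_, t, ht, h.symm, rfl⟩
  -- Take a generating subset of least cardinality: an element in the span of the others could be
  -- erased.
  obtain ⟨t, ht, hspan, hcard⟩ := Nat.find_spec hex
  have hmin : ∀ t' : Finset M, (t' : Set M) ⊆ T →
      Submodule.span R (t' : Set M) = Submodule.span R T → t.card ≤ t'.card :=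
    fun t' h h' => hcard ▸ Nat.find_min' hex ⟨t', h, h', rfl⟩
  let e := t.equivFin.symm
  have hrange : Set.range (fun j => (e j : M)) = t := by
    ext x
    exact ⟨by rintro ⟨j, rfl⟩; exact (e j).2, fun hx => ⟨e.symm ⟨x, hx⟩, by simp⟩⟩
  refine ⟨t.card, fun j => e j, fun j => ht (e j).2, by rw [hrange, hspan], fun j hj => ?_,
    fun hT => ?_⟩
  · have himg : (fun j => (e j : M)) '' {j}ᶜ ⊆ (t.erase (e j) : Finset M) := by
      rintro _ ⟨k, hk, rfl⟩
      simp only [Finset.coe_erase, Set.mem_sdiff, Finset.mem_coe, Finset.coe_mem, true_and,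
        Set.mem_singleton_iff]
      exact fun h => hk (e.injective (Subtype.ext h))
    have h1 := Submodule.span_mono (R := R) himg hj
    refine absurd (hmin (t.erase (e j)) ?_ ?_) (not_le.2 (Finset.card_erase_lt_of_mem (e j).2))
    · exact (Finset.coe_subset.2 (Finset.erase_subset _ _)).trans ht
    · rw [← hspan]
      refine le_antisymm (Submodule.span_mono (Finset.coe_subset.2 (Finset.erase_subset _ _)))
        (Submodule.span_le.2 fun x hx => ?_)
      by_cases h : x = e j
      · rw [h]; exact h1
      · exact Submodule.subset_span (Finset.mem_coe.2 (Finset.mem_erase.2 ⟨h, hx⟩))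
  · have := hmin hT.toFinset (by simp) (by simp)
    rwa [← Set.ncard_eq_toFinset_card T hT] at this

theorem mem_ideal_smul_top_of_forall_mem {J : Type*} [Finite J] (𝔪 : Ideal R) (c : J → R)
    (hc : ∀ j, c j ∈ 𝔪) : c ∈ 𝔪 • (⊤ : Submodule R (J → R)) := by
  classical
  have := Fintype.ofFinite J
  rw [pi_eq_sum_univ' c]
  exact Submodule.sum_mem _ fun j _ => Submodule.smul_mem_smul (hc j) trivial

end Irredundant

/-! ### Fine grading and syzygies of monomials. -/

namespace MvPolynomial

variable {K σ : Type*} [Field K]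

/-- Relations between irredundant homogeneous elements (for the fine grading) have coefficients
without constant term. -/
theorem constantCoeff_eq_zero_of_irredundant {J ι M : Type*} [Fintype J] [AddCommGroup M]
    [Module (MvPolynomial σ K) M] (D : M →ₗ[MvPolynomial σ K] (ι → MvPolynomial σ K))
    (hD : Function.Injective D) (w : J → M) (d : J → σ →₀ ℕ) (u : J → ι → K)
    (hDw : ∀ j k, D (w j) k = monomial (d j) (u j k))
    (hw : ∀ j, w j ∉ Submodule.span (MvPolynomial σ K) (w '' {j}ᶜ))
    (c : J → MvPolynomial σ K) (hc : ∑ j, c j • w j = 0) (i : J) :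
    constantCoeff (c i) = 0 := by
  classical
  by_contra ha
  -- This is the part of the relation in degree `d i`. Its `i`-th coefficient is the constant term
  -- of `c i`; were that nonzero, `w i` could be solved for.
  let c' : J → MvPolynomial σ K := fun j =>
    if d j ≤ d i then monomial (d i - d j) (coeff (d i - d j) (c j)) else 0
  have hci : c' i = C (constantCoeff (c i)) := by
    simp [c', constantCoeff_eq]
  have hsum : ∑ j, c' j • w j = 0 := by
    refine hD ?_
    rw [map_zero]
    funext k
    have h1 := congrArg (coeff (d i)) (congrFun (congrArg D hc) k)
    simp only [map_sum, map_smul, Finset.sum_apply, Pi.smul_apply, hDw, smul_eq_mul, coeff_sum,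
      coeff_mul_monomial', map_zero, Pi.zero_apply, coeff_zero] at h1 ⊢
    rw [← monomial_zero (s := d i), ← h1, map_sum]
    refine Finset.sum_congr rfl fun j _ => ?_
    by_cases hj : d j ≤ d i
    · simp [c', hj, monomial_mul, tsub_add_cancel_of_le hj]
    · simp [c', hj]
  rw [← Finset.add_sum_erase _ _ (Finset.mem_univ i), hci, add_eq_zero_iff_eq_neg] at hsum
  refine hw i ?_
  have : w i = (C (constantCoeff (c i))⁻¹ : MvPolynomial σ K) •
      ((C (constantCoeff (c i)) : MvPolynomial σ K) • w i) := by
    rw [smul_smul, ← C_mul, inv_mul_cancel₀ ha, C_1, one_smul]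
  rw [this, hsum]
  refine Submodule.smul_mem _ _ (Submodule.neg_mem _ (Submodule.sum_mem _ fun j hj => ?_))
  exact Submodule.smul_mem _ _ (Submodule.subset_span ⟨j, Finset.ne_of_mem_erase hj, rfl⟩)

section Syzygies

variable {r : ℕ} (d : Fin r → σ →₀ ℕ)

/-- The syzygy between two monomials given by their least common multiple. -/
noncomputable def monomialSyzygy (K : Type*) [Field K] (i j : Fin r) : Fin r → MvPolynomial σ K :=
  Pi.single i (monomial (d i ⊔ d j - d i) 1) - Pi.single j (monomial (d i ⊔ d j - d j) 1)

/-- Rescaling of coordinates by monomials. -/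
noncomputable def monomialScale (K : Type*) [Field K] :
    (Fin r → MvPolynomial σ K) →ₗ[MvPolynomial σ K] (Fin r → MvPolynomial σ K) :=
  LinearMap.pi fun k => (monomial (d k) (1 : K)) • LinearMap.proj k

theorem monomialScale_injective : Function.Injective (monomialScale d K) := by
  intro v w h
  funext k
  have := congrFun h k
  simpa [monomialScale, monomial_eq_zero] using this

/-- Rescaling puts every coordinate of a pairwise syzygy in the single degree `d i ⊔ d j`, the
homogeneous form that `constantCoeff_eq_zero_of_irredundant` requires. -/
theorem monomialScale_monomialSyzygy (i j k : Fin r) :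
    monomialScale d K (monomialSyzygy d K i j) k =
      monomial (d i ⊔ d j) (Pi.single (M := fun _ => K) i 1 k - Pi.single (M := fun _ => K) j 1 k) := by
  have h1 : d i + (d i ⊔ d j - d i) = d i ⊔ d j := add_tsub_cancel_of_le le_sup_left
  have h2 : d j + (d i ⊔ d j - d j) = d i ⊔ d j := add_tsub_cancel_of_le le_sup_right
  simp only [monomialScale, monomialSyzygy, LinearMap.pi_apply, LinearMap.smul_apply,
    LinearMap.proj_apply, smul_eq_mul, map_sub]
  congr 1
  · by_cases h : k = i
    · subst h; simp [monomial_mul, h1]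
    · simp [h]
  · by_cases h : k = j
    · subst h; simp [monomial_mul, h2]
    · simp [h]

theorem monomialSyzygy_swap (i j : Fin r) :
    monomialSyzygy d K j i = - monomialSyzygy d K i j := by
  simp [monomialSyzygy, sup_comm]

theorem linearCombination_monomialSyzygy (i j : Fin r) :
    Fintype.linearCombination (MvPolynomial σ K) (fun j => monomial (d j) (1 : K))
      (monomialSyzygy d K i j) = 0 := by
  have h1 : d i ⊔ d j - d i + d i = d i ⊔ d j := tsub_add_cancel_of_le le_sup_left
  have h2 : d i ⊔ d j - d j + d j = d i ⊔ d j := tsub_add_cancel_of_le le_sup_right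
  simp [monomialSyzygy, Fintype.linearCombination_apply_single, monomial_mul, h1, h2]

/-- The component of degree `e` of a vector, where the `k`-th basis vector has degree `d k`. -/
noncomputable def fineComponent (e : σ →₀ ℕ) (c : Fin r → MvPolynomial σ K) :
    Fin r → MvPolynomial σ K :=
  open Classical in
  fun k => if d k ≤ e then monomial (e - d k) (coeff (e - d k) (c k)) else 0

theorem exists_sum_fineComponent_eq (c : Fin r → MvPolynomial σ K) :
    ∃ T : Finset (σ →₀ ℕ), ∑ e ∈ T, fineComponent d e c = c := by
  classical
  -- A monomial of exponent `m` in coordinate `k` has degree `m + d k`.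
  refine ⟨Finset.univ.biUnion fun k => (c k).support.image (· + d k), ?_⟩
  funext k
  ext m
  simp only [Finset.sum_apply, coeff_sum, fineComponent]
  rw [Finset.sum_eq_single (m + d k)]
  · simp
  · intro e _ he
    split_ifs with h
    · rw [coeff_monomial, if_neg]
      rintro rfl
      exact he (tsub_add_cancel_of_le h).symm
    · simp
  · intro h
    have : coeff m (c k) = 0 := by
      by_contra h'
      exact h (Finset.mem_biUnion.2 ⟨k, Finset.mem_univ _,
        Finset.mem_image.2 ⟨m, mem_support_iff.2 h', rfl⟩⟩)
    simp [this]

/-- In degree `e` a syzygy amounts to scalars `a k` with sum zero, supported where `d k ≤ e`. Such a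
vector is a combination of differences with one fixed index `k₀`, and each difference is a monomial
multiple of a pairwise syzygy. -/
theorem fineComponent_mem_span_monomialSyzygy (e : σ →₀ ℕ) (c : Fin r → MvPolynomial σ K)
    (hc : Fintype.linearCombination (MvPolynomial σ K) (fun j => monomial (d j) (1 : K)) c = 0) :
    fineComponent d e c ∈ Submodule.span (MvPolynomial σ K)
      {v | ∃ i j, v = monomialSyzygy d K i j} := by
  classical
  by_cases hex : ∃ k₀, d k₀ ≤ e
  · obtain ⟨k₀, hk₀⟩ := hex
    let a : Fin r → K := fun k => if d k ≤ e then coeff (e - d k) (c k) else 0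
    have ha : ∑ k, a k = 0 := by
      have := congrArg (coeff e) hc
      simpa [Fintype.linearCombination_apply, coeff_sum, coeff_mul_monomial', a] using this
    have hle : ∀ k, d k ≤ e → d k ⊔ d k₀ ≤ e := fun k hk => sup_le hk hk₀
    have : fineComponent d e c =
        ∑ k, monomial (e - d k ⊔ d k₀) (a k) • monomialSyzygy d K k k₀ := by
      have h1 : ∀ k, monomial (e - d k ⊔ d k₀) (a k) • monomialSyzygy d K k k₀ =
          Pi.single k (fineComponent d e c k) - Pi.single k₀ (monomial (e - d k₀) (a k)) := by
        intro k
        by_cases hk : d k ≤ e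
        · have e1 : e - d k ⊔ d k₀ + (d k ⊔ d k₀ - d k) = e - d k :=
            tsub_add_tsub_cancel (hle k hk) le_sup_left
          have e2 : e - d k ⊔ d k₀ + (d k ⊔ d k₀ - d k₀) = e - d k₀ :=
            tsub_add_tsub_cancel (hle k hk) le_sup_right
          simp only [monomialSyzygy, smul_sub, ← Pi.single_smul, smul_eq_mul, monomial_mul, e1, e2,
            mul_one, fineComponent, a, if_pos hk]
        · simp [a, hk, fineComponent]
      simp only [h1, Finset.sum_sub_distrib]
      rw [Finset.univ_sum_single]
      have : ∑ k, Pi.single (M := fun _ => MvPolynomial σ K) k₀ (monomial (e - d k₀) (a k)) = 0 := by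
        funext k
        rw [Finset.sum_apply]
        by_cases h : k = k₀
        · subst h
          simp only [Pi.single_eq_same, ← map_sum, ha, map_zero, Pi.zero_apply]
        · simp [h]
      rw [this, sub_zero]
    rw [this]
    exact Submodule.sum_mem _ fun k _ => Submodule.smul_mem _ _
      (Submodule.subset_span ⟨k, k₀, rfl⟩)
  · have : fineComponent d e c = 0 := by
      funext k
      exact if_neg fun h => hex ⟨k, h⟩
    rw [this]
    exact Submodule.zero_mem _

/-- The syzygies of a family of monomials are generated by the pairwise ones. -/
theorem ker_linearCombination_monomial :
    LinearMap.ker (Fintype.linearCombination (MvPolynomial σ K)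
      (fun j => monomial (d j) (1 : K))) =
    Submodule.span (MvPolynomial σ K)
      ((fun p : Fin r × Fin r => monomialSyzygy d K p.1 p.2) '' {p | p.1 < p.2}) := by
  apply le_antisymm
  · intro c hc
    obtain ⟨T, hT⟩ := exists_sum_fineComponent_eq d c
    rw [← hT]
    refine Submodule.sum_mem _ fun e _ => ?_
    refine Submodule.span_le.2 ?_ (fineComponent_mem_span_monomialSyzygy d e c hc)
    rintro _ ⟨i, j, rfl⟩
    rcases lt_trichotomy i j with h | rfl | h
    · exact Submodule.subset_span ⟨(i, j), h, rfl⟩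
    · simp [monomialSyzygy]
    · rw [monomialSyzygy_swap]
      exact Submodule.neg_mem _ (Submodule.subset_span ⟨(j, i), h, rfl⟩)
  · rw [Submodule.span_le]
    rintro _ ⟨p, -, rfl⟩
    exact linearCombination_monomialSyzygy d p.1 p.2

theorem ncard_monomialSyzygy_le :
    ((fun p : Fin r × Fin r => monomialSyzygy d K p.1 p.2) '' {p | p.1 < p.2}).ncard ≤
      r.choose 2 := by
  classical
  refine (Set.ncard_image_le (Set.toFinite _)).trans ?_
  have : ({p : Fin r × Fin r | p.1 < p.2}).ncard ≤
      (Finset.powersetCard 2 (Finset.univ : Finset (Fin r)) : Set (Finset (Fin r))).ncard := by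
    refine Set.ncard_le_ncard_of_injOn (fun p => {p.1, p.2}) ?_ ?_ (Set.toFinite _)
    · intro p hp
      simpa using Finset.card_pair (ne_of_lt hp)
    · rintro ⟨i, j⟩ hij ⟨k, l⟩ hkl h
      simp only [Set.mem_ofPred_eq] at hij hkl
      simp only [Finset.ext_iff, Finset.mem_insert, Finset.mem_singleton] at h
      have h1 := h i
      have h2 := h j
      have h3 := h k
      have h4 := h l
      simp only [Prod.mk.injEq]
      grind
  simpa [Set.ncard_coe_finset] using this

end Syzygies

end MvPolynomial

/-! ### The minimal resolution of a monomial ideal. -/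

section MonomialIdeal

universe u

theorem hasProjectiveDimensionLT_iff_ker {R F M : Type u} [CommRing R] [AddCommGroup F]
    [Module R F] [Module.Projective R F] [AddCommGroup M] [Module R M] (p : F →ₗ[R] M)
    (hp : Function.Surjective p) (n : ℕ) :
    HasProjectiveDimensionLT (ModuleCat.of R M) (n + 2) ↔
      HasProjectiveDimensionLT (ModuleCat.of R (LinearMap.ker p)) (n + 1) :=
  (LinearMap.shortExact_shortComplexKer hp).hasProjectiveDimensionLT_X₃_iff n
    ((IsProjective.iff_projective F).1 inferInstance)

theorem hasProjectiveDimensionLT_one_iff {R M : Type u} [CommRing R] [AddCommGroup M]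
    [Module R M] :
    HasProjectiveDimensionLT (ModuleCat.of R M) 1 ↔ Module.Projective R M :=
  projective_iff_hasProjectiveDimensionLT_one.symm.trans (IsProjective.iff_projective M).symm

theorem projective_of_ker_eq_bot {R F M : Type*} [CommRing R] [AddCommGroup F]
    [Module R F] [Module.Projective R F] [AddCommGroup M] [Module R M] (p : F →ₗ[R] M)
    (hp : Function.Surjective p) (h : LinearMap.ker p = ⊥) : Module.Projective R M :=
  Module.Projective.of_equiv (LinearEquiv.ofBijective p ⟨LinearMap.ker_eq_bot.1 h, hp⟩)

theorem finrank_ker_add_finrank {R F M : Type u} [CommRing R] [IsDomain R] [AddCommGroup F]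
    [Module R F] [Module.Finite R F] [AddCommGroup M] [Module R M] (p : F →ₗ[R] M)
    (hp : Function.Surjective p) :
    Module.finrank R (LinearMap.ker p) + Module.finrank R M = Module.finrank R F := by
  rw [← Submodule.finrank_quotient_add_finrank (LinearMap.ker p),
    (p.quotKerEquivOfSurjective hp).finrank_eq, add_comm]

theorem Ideal.finrank_eq_one {R : Type*} [CommRing R] [IsDomain R] [IsNoetherianRing R]
    (I : Ideal R) (hI : I ≠ ⊥) : Module.finrank R I = 1 := by
  refine le_antisymm ((Submodule.finrank_le I).trans (Module.finrank_self R).le) ?_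
  exact Module.finrank_pos_iff.2 ((Submodule.nontrivial_iff_ne_bot (p := I)).2 hI)

variable {K : Type u} [Field K] {n : ℕ}

open MvPolynomial in
/-- The start of the minimal free resolution of a monomial ideal. -/
theorem IsMonomialIdeal.exists_minimal_presentation {I : Ideal (MvPolynomial (Fin n) K)}
    (hI : IsMonomialIdeal I) :
    ∃ (r₀ r₁ : ℕ) (p : (Fin r₀ → MvPolynomial (Fin n) K) →ₗ[MvPolynomial (Fin n) K] I)
      (f : (Fin r₁ → MvPolynomial (Fin n) K) →ₗ[MvPolynomial (Fin n) K] LinearMap.ker p),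
      Function.Surjective p ∧ Function.Surjective f ∧
      LinearMap.ker p ≤ idealOfVars (Fin n) K • ⊤ ∧
      LinearMap.ker f ≤ idealOfVars (Fin n) K • ⊤ ∧ r₁ ≤ r₀.choose 2 := by
  obtain ⟨A, hA⟩ := hI
  obtain ⟨r₀, w, hwA, hwspan, hwirr, -⟩ := exists_irredundant_family
    (R := MvPolynomial (Fin n) K) ((fun a => monomial a (1 : K)) '' A)
  choose d hdA hdw using hwA
  obtain rfl : w = fun j => monomial (d j) 1 := funext fun j => (hdw j).symm
  have hrange : LinearMap.range (Fintype.linearCombination (MvPolynomial (Fin n) K)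
      (fun j => monomial (d j) (1 : K))) = I := by
    rw [Fintype.range_linearCombination, hwspan, hA, Ideal.span]
  have hkerp : LinearMap.ker (Fintype.linearCombination (MvPolynomial (Fin n) K)
      (fun j => monomial (d j) (1 : K))) ≤ idealOfVars (Fin n) K • ⊤ := by
    intro c hc
    refine mem_ideal_smul_top_of_forall_mem _ c fun j => (mem_idealOfVars_iff _).2 ?_
    refine constantCoeff_eq_zero_of_irredundant
      (LinearMap.pi fun _ : Unit => LinearMap.id) (fun v w h => congrFun h ())
      (fun j => monomial (d j) (1 : K)) d (fun _ _ => 1) (fun _ _ => rfl) hwirr c ?_ j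
    simpa [Fintype.linearCombination_apply] using hc
  obtain ⟨r₁, s, hsA, hsspan, hsirr, hscard⟩ := exists_irredundant_family
    (R := MvPolynomial (Fin n) K)
    ((fun q : Fin r₀ × Fin r₀ => monomialSyzygy d K q.1 q.2) '' {q | q.1 < q.2})
  have hrange₁ : LinearMap.range (Fintype.linearCombination (MvPolynomial (Fin n) K) s) =
      LinearMap.ker (Fintype.linearCombination (MvPolynomial (Fin n) K)
        (fun j => monomial (d j) (1 : K))) := by
    rw [Fintype.range_linearCombination, hsspan, ker_linearCombination_monomial]
  have hkerf : LinearMap.ker (Fintype.linearCombination (MvPolynomial (Fin n) K) s) ≤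
      idealOfVars (Fin n) K • ⊤ := by
    intro c hc
    choose q hq hqs using hsA
    refine mem_ideal_smul_top_of_forall_mem _ c fun j => (mem_idealOfVars_iff _).2 ?_
    -- The second syzygies are handled like the first, now with the rescaling as the embedding.
    refine constantCoeff_eq_zero_of_irredundant (monomialScale d K) (monomialScale_injective d)
      s (fun j => d (q j).1 ⊔ d (q j).2) (fun j k => Pi.single (M := fun _ => K) (q j).1 1 k -
        Pi.single (M := fun _ => K) (q j).2 1 k) (fun j k => ?_) hsirr c hc j
    rw [← hqs]
    exact monomialScale_monomialSyzygy d _ _ _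
  have hmem : ∀ c, Fintype.linearCombination (MvPolynomial (Fin n) K)
      (fun j => monomial (d j) (1 : K)) c ∈ I := fun c => hrange ▸ LinearMap.mem_range_self _ c
  have hker := LinearMap.ker_codRestrict I _ hmem
  refine ⟨r₀, r₁, LinearMap.codRestrict I _ hmem,
    LinearMap.codRestrict _ (Fintype.linearCombination (MvPolynomial (Fin n) K) s) fun c => ?_,
    ?_, ?_, ?_, ?_, ?_⟩
  · rw [hker, ← hrange₁]
    exact LinearMap.mem_range_self _ c
  · rintro ⟨y, hy⟩
    rw [← hrange] at hy
    obtain ⟨c, hc⟩ := hy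
    exact ⟨c, Subtype.ext hc⟩
  · rintro ⟨y, hy⟩
    rw [hker, ← hrange₁] at hy
    obtain ⟨c, hc⟩ := hy
    exact ⟨c, Subtype.ext hc⟩
  · rw [hker]
    exact hkerp
  · rw [LinearMap.ker_codRestrict]
    exact hkerf
  · exact (hscard (Set.toFinite _)).trans (ncard_monomialSyzygy_le d)

/-- Two dimension shifts make `ker f` projective, so it is the last term of a minimal resolution.
Additivity of rank gives the Euler relation; the vanishing criteria hold because a module with a
minimal cover is projective exactly when the kernel of the cover is zero. -/
theorem exists_bettiNumber_eq (I : Ideal (MvPolynomial (Fin n) K))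
    (hI : IsMonomialIdeal I) (hI0 : I ≠ ⊥) (hpd : projDim I ≤ 2) :
    ∃ p r₀ r₁ r₂ : ℕ, projDim I = p ∧ bettiNumber I 0 = r₀ ∧ bettiNumber I 1 = r₁ ∧
      bettiNumber I 2 = r₂ ∧ p ≤ 2 ∧ r₀ + r₂ = r₁ + 1 ∧ r₁ ≤ r₀.choose 2 ∧
      (r₁ = 0 ↔ p = 0) ∧ (r₂ = 0 ↔ p ≤ 1) := by
  obtain ⟨r₀, r₁, p, f, hp, hf, hp𝔪, hf𝔪, hle⟩ := hI.exists_minimal_presentation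
  have h𝔪 := (MvPolynomial.isMaximal_idealOfVars (K := K) (Fin n)).ne_top
  have hpd' : HasProjectiveDimensionLT (ModuleCat.of (MvPolynomial (Fin n) K) I) 3 :=
    (projectiveDimension_le_iff _ 2).1 hpd
  rw [hasProjectiveDimensionLT_iff_ker p hp, hasProjectiveDimensionLT_iff_ker f hf,
    hasProjectiveDimensionLT_one_iff] at hpd'
  have e1 := finrank_ker_add_finrank p hp
  have e2 := finrank_ker_add_finrank f hf
  rw [Ideal.finrank_eq_one I hI0, Module.finrank_fin_fun] at e1
  rw [Module.finrank_fin_fun] at e2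
  obtain ⟨b0, b1, b2⟩ := bettiNumber_eq_finrank I p ((LinearMap.ker p).subtype ∘ₗ f)
    (LinearMap.ker f).subtype hp
    (fun x => ⟨fun hx => (hf ⟨x, hx⟩).imp fun y hy => congrArg Subtype.val hy, by
      rintro ⟨y, rfl⟩; exact (f y).2⟩)
    (fun x => ⟨fun hx => ⟨⟨x, Subtype.ext hx⟩, rfl⟩, by
      rintro ⟨y, rfl⟩; exact congrArg Subtype.val y.2⟩)
    Subtype.val_injective (fun x => hp𝔪 (f x).2) (fun x => hf𝔪 x.2)
  rw [Module.finrank_fin_fun] at b0 b1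
  have hker₂ : Module.finrank (MvPolynomial (Fin n) K) (LinearMap.ker f) = 0 ↔
      Module.Projective (MvPolynomial (Fin n) K) (LinearMap.ker p) := by
    rw [Submodule.finrank_eq_zero]
    exact ⟨projective_of_ker_eq_bot f hf, fun _ => ker_eq_bot_of_projective _ h𝔪 f hf hf𝔪⟩
  have hker₁ : r₁ = 0 ↔ Module.Projective (MvPolynomial (Fin n) K) I := by
    constructor
    · intro h
      have h0 : Module.finrank (MvPolynomial (Fin n) K) (LinearMap.ker p) = 0 := by omega
      exact projective_of_ker_eq_bot p hp (Submodule.finrank_eq_zero.1 h0)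
    -- If `I` is projective, `ker p` is zero, hence itself projective; so `ker f` has rank zero too,
    -- and `r₁` is the sum of these two ranks.
    · intro _
      have h1 := ker_eq_bot_of_projective _ h𝔪 p hp hp𝔪
      have h2 : Module.finrank (MvPolynomial (Fin n) K) (LinearMap.ker p) = 0 :=
        Submodule.finrank_eq_zero.2 h1
      have : Subsingleton (LinearMap.ker p) := by rw [h1]; infer_instance
      have h3 := hker₂.2 inferInstance
      omega
  obtain ⟨q, hq⟩ : ∃ q : ℕ, projDim I = q := by
    have hbot : projDim I ≠ ⊥ := by
      intro h
      have h1 := (projectiveDimension_eq_bot_iff _).1 h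
      have h2 := ModuleCat.subsingleton_of_isZero h1
      exact hI0 ((Submodule.subsingleton_iff_eq_bot (p := I)).1 h2)
    obtain ⟨e, he⟩ := WithBot.ne_bot_iff_exists.1 hbot
    have he2 : e ≤ 2 := by
      rw [← he] at hpd
      exact WithBot.coe_le_coe.1 hpd
    lift e to ℕ using ne_top_of_le_ne_top (by simp) he2
    exact ⟨e, he.symm⟩
  have hq' : ∀ k : ℕ, q ≤ k ↔
      HasProjectiveDimensionLE (ModuleCat.of (MvPolynomial (Fin n) K) I) k := by
    intro k
    rw [← projectiveDimension_le_iff, ← projDim, hq]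
    exact_mod_cast Iff.rfl
  refine ⟨q, r₀, r₁, _, hq, b0, b1, b2, ?_, by omega, hle, ?_, ?_⟩
  · rw [hq] at hpd
    exact_mod_cast hpd
  · rw [hker₁, ← Nat.le_zero, hq' 0, ← hasProjectiveDimensionLT_one_iff]
  · rw [hker₂, hq' 1, ← hasProjectiveDimensionLT_one_iff]
    exact (hasProjectiveDimensionLT_iff_ker p hp 0).symm

end MonomialIdeal

theorem mainTheorem6 {K : Type*} [Field K] {n : ℕ} (I : Ideal (MvPolynomial (Fin n) K))
    (hI : IsMonomialIdeal I) (hI0 : I ≠ ⊥) (hpd : projDim I ≤ 2) :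
    ∃ (m : ℕ) (Δ : AbstractSimplicialComplex (Fin m)),
      Δ.IsAcyclic K ∧ Δ.fVector = bettiSequence I := by
  obtain ⟨p, r₀, r₁, r₂, hp, h₀, h₁, h₂, hp2, euler, hle, hr₁, hr₂⟩ :=
    exists_bettiNumber_eq I hI hI0 hpd
  have hlen : ((projDim I).unbotD 0).toNat = p := by
    rw [hp]
    rfl
  rw [bettiSequence, hlen]
  exact AbstractSimplicialComplex.exists_isAcyclic_fVector_eq K _ h₀ h₁ h₂ hp2 euler hle hr₁ hr₂
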